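/- Let $(\mathcal X,d)$ be a finite metric space. For $F\subseteq\mathcal X$ put $d(x,F)=\min_{f\in F}d(x,f)$, with $d(x,\emptyset)=\infty$, and let $\mathrm{Opt}=\min_{F\subseteq\mathcal X}\bigl(\sum_{x\in\mathcal X}d(x,F)+|F|\bigr)$ be the cost of an optimal solution of the uniform facility location problem. For $X\subseteq\mathcal X$ and $x\in X$, the radius of $x$ in $X$ is the unique $r_x>0$ with $\sum_{y\in X,\ d(x,y)\le r_x}(r_x-d(y,x))=1$. Fix a constant $c\ge 6$. The procedure $\textsc{RecursiveUniformFL}(X,F,d)$ computes the radii $r_x$ of the points $x\in X$ in $X$, opens a facility at each $x\in X$ independently with probability $\min\{1,\ c\cdot d(x,F),\ c\cdot r_x\}$, and returns the set $S$ of all open facilities (those in $F$ and the newly opened ones) together with the set $R$ of all $x\in X$ for which no $f\in S$ satisfies $d(x,f)\le 6r_x$ (the other points of $X$ are assigned to their closest open facility). The algorithm $\textsc{UniformFLRecursionStart}(\mathcal X,d)$ starts with $F=\emptyset$ and $X=\mathcal X$; while $X\ne\emptyset$, it computes $(S,R)=\textsc{RecursiveUniformFL}(X,F,d)$, with fresh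 independent randomness, and replaces $F$ by $F\cup S$ and $X$ by $R$; finally it returns $F$. Then for every constant $c\ge 6$ there is a constant $C$, depending only on $c$, such that for every finite metric space $(\mathcal X,d)$ the algorithm $\textsc{UniformFLRecursionStart}(\mathcal X,d)$ terminates with probability $1$, and the set $F$ that it returns satisfies $$\mathbb E\bigl[|F|\bigr]\le C\cdot \mathrm{Opt}.$$ -/

import Mathlib

open scoped ENNReal NNReal

noncomputable section

namespace UniFL

variable {α : Type*} [MetricSpace α]

/-! ### The uniform facility location problem -/

/-- The value `∑_{x} d(x, F) + |F|` of a set `F` of open facilities. Here `d(x, F)` is the smallest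
distance from `x` to a point of `F`, with `d(x, ∅) = ∞`. -/
def cost [Fintype α] (F : Finset α) : ℝ≥0∞ :=
  (∑ x : α, Metric.infEDist x (F : Set α)) + (F.card : ℝ≥0∞)

variable (α) in
/-- The cost of an optimal solution (the infimum is over the finitely many subsets `F`). -/
def opt [Fintype α] : ℝ≥0∞ := ⨅ F : Finset α, cost F

/-! ### Radii -/

/-- `r` is a radius of the point `x` in the finite metric space `X`:
`r > 0` and `∑_{y ∈ X ∩ B(x, r)} (r - d(y, x)) = 1`. -/
def IsRadius (X : Finset α) (x : α) (r : ℝ) : Prop :=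
  0 < r ∧ ∑ y ∈ X with dist x y ≤ r, (r - dist y x) = 1

theorem sum_ball_eq (X : Finset α) (x : α) (r : ℝ) :
    ∑ y ∈ X with dist x y ≤ r, (r - dist y x) = ∑ y ∈ X, max (r - dist y x) 0 := by
  rw [Finset.sum_filter]
  refine Finset.sum_congr rfl fun y _ => ?_
  rw [dist_comm x y]
  split_ifs with h
  · rw [max_eq_left (by linarith)]
  · rw [max_eq_right (by linarith)]

/-- Every point of a finite metric space has exactly one radius. -/
theorem existsUnique_isRadius {X : Finset α} {x : α} (hx : x ∈ X) : ∃! r, IsRadius X x r := by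
  have hmono : ∀ r s : ℝ, 0 < r → r < s →
      ∑ y ∈ X, max (r - dist y x) 0 < ∑ y ∈ X, max (s - dist y x) 0 := by
    intro r s hr hrs
    refine Finset.sum_lt_sum (fun y _ => max_le_max (by linarith) le_rfl) ⟨x, hx, ?_⟩
    rw [dist_self, max_eq_left (by linarith), max_eq_left (by linarith)]
    linarith
  have hcont : Continuous fun r : ℝ => ∑ y ∈ X, max (r - dist y x) 0 := by fun_prop
  have h0 : ∑ y ∈ X, max ((0 : ℝ) - dist y x) 0 = 0 :=
    Finset.sum_eq_zero fun y _ => max_eq_right (by linarith [dist_nonneg (x := y) (y := x)])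
  have h1 : (1 : ℝ) ≤ ∑ y ∈ X, max ((1 : ℝ) - dist y x) 0 := by
    refine le_trans ?_ (Finset.single_le_sum
      (f := fun y => max ((1 : ℝ) - dist y x) 0) (fun y _ => le_max_right _ _) hx)
    simp
  obtain ⟨r, hr, hr1⟩ := intermediate_value_Icc (zero_le_one' ℝ) hcont.continuousOn
    (show (1 : ℝ) ∈ Set.Icc _ _ from ⟨by simp only [h0]; exact zero_le_one, h1⟩)
  have hr0 : 0 < r := by
    rcases hr.1.lt_or_eq with h | h
    · exact h
    · subst h
      simp only [h0] at hr1
      exact absurd hr1 zero_ne_one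
  refine ⟨r, ⟨hr0, by rw [sum_ball_eq]; exact hr1⟩, ?_⟩
  rintro s ⟨hs0, hs1⟩
  rw [sum_ball_eq] at hs1
  rcases lt_trichotomy s r with h | h | h
  · exact absurd (hmono s r hs0 h) (by rw [hs1]; simp only at hr1; rw [hr1]; exact lt_irrefl _)
  · exact h
  · exact absurd (hmono r s hr0 h) (by rw [hs1]; simp only at hr1; rw [hr1]; exact lt_irrefl _)

open Classical in
/-- The radius `r_x` of the point `x ∈ X` in the finite metric space `X`
(for `x ∉ X`, where it is never used, the value is `0`). -/
def radius (X : Finset α) (x : α) : ℝ :=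
  if hx : x ∈ X then (existsUnique_isRadius hx).choose else 0

theorem isRadius_radius {X : Finset α} {x : α} (hx : x ∈ X) : IsRadius X x (radius X x) := by
  rw [radius, dif_pos hx]
  exact (existsUnique_isRadius hx).choose_spec.1

/-! ### Independent opening of facilities -/

open Classical in
/-- The random subset of `X` that contains each `x ∈ X` with probability `p x`,
independently for the different points. -/
def independentSubset {β : Type*} (X : Finset β) (p : β → ℝ≥0∞) (hp : ∀ x, p x ≤ 1) :
    PMF (Finset β) :=
  PMF.ofFinset
    (fun S => if S ⊆ X then (∏ x ∈ S, p x) * ∏ x ∈ X \ S, (1 - p x) else 0) X.powerset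
    (by
      rw [Finset.sum_congr rfl fun S hS => if_pos (Finset.mem_powerset.1 hS),
        ← Finset.prod_add]
      exact Finset.prod_eq_one fun x _ => add_tsub_cancel_of_le (hp x))
    (fun S hS => if_neg fun h => hS (Finset.mem_powerset.2 h))

/-- The opening probability `min {1, c · d(x, F), c · r_x}` of the point `x` of the current
metric space `X`, where `F` is the set of facilities that are already open (`d(x, ∅) = ∞`). -/
def openProb (c : ℝ) (X F : Finset α) (x : α) : ℝ≥0∞ :=
  min 1 (min (ENNReal.ofReal c * Metric.infEDist x (F : Set α))
    (ENNReal.ofReal c * ENNReal.ofReal (radius X x)))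

theorem openProb_le_one (c : ℝ) (X F : Finset α) (x : α) : openProb c X F x ≤ 1 :=
  min_le_left _ _

/-! ### The algorithms -/

open Classical in
/-- `RecursiveUniformFL (X, F, d)`: with radii computed in `X`, each `x ∈ X` independently opens a
facility with probability `min {1, c · d(x, F), c · r_x}`. The points of `X` that have an open
facility (old or new) at distance at most `6 · r_x` are assigned. Returned are the set of open
facilities and the set `R` of the points of `X` that are not assigned. -/
def recursiveUniformFL (c : ℝ) (X F : Finset α) : PMF (Finset α × Finset α) :=
  (independentSubset X (openProb c X F) (openProb_le_one c X F)).map fun S =>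
    (F ∪ S, X.filter fun x => ¬ ∃ f ∈ F ∪ S, dist x f ≤ 6 * radius X x)

open Classical in
/-- One turn of the loop `while X ≠ ∅ do (S, R := RecursiveUniformFL (X, F, d); F := F ∪ S; X := R)`
on a state `(F, X)`; a state with `X = ∅` is final. -/
def loopStep (c : ℝ) (s : Finset α × Finset α) : PMF (Finset α × Finset α) :=
  if s.2 = ∅ then PMF.pure s
  else (recursiveUniformFL c s.2 s.1).map fun SR => (s.1 ∪ SR.1, SR.2)

/-- The law of the state `(F, X)` of `UniformFLRecursionStart` after `n` turns of its loop, when it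
is started with `F = ∅` and `X` the whole space. -/
def stateLaw [Fintype α] (c : ℝ) : ℕ → PMF (Finset α × Finset α)
  | 0 => PMF.pure (∅, Finset.univ)
  | n + 1 => (stateLaw c n).bind (loopStep c)

/-- The probability that `UniformFLRecursionStart` terminates and returns the set `F`. A state with
`X = ∅` is never left, so the supremum is the limit of an increasing sequence. -/
def outputProb [Fintype α] (c : ℝ) (F : Finset α) : ℝ≥0∞ :=
  ⨆ n : ℕ, stateLaw c n (F, ∅)

end UniFL

end

/-!
Fix a solution `K` and let `φ` send each point `x` to its closest point of `K`, its center; write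
`δ x` for the distance between them. The proof bounds the expected number of facilities opened by
the points of each cluster, the set of points with a common center `f`.

* After a round, each current point `x` has a facility within its radius `r_x` with probability at
  least one half, whatever happened before (`expect_no_facility_le`). If no facility is that close
  beforehand, then by the Lipschitz property of the radius each `y` in the ball opens with
  probability at least `min {1, c · (r_x - d(x, y))}`, and the weights add up to one. So each point
  survives a round with probability at most one half. This gives termination, and any cost of
  `O(δ x)` per round in which `x` is present adds up to `O(δ x)` in expectation.
* A point with `r_x ≤ 4 δ x` opens with probability at most `4 c · δ x`, which is such a cost. The
  other points of a cluster, its core points, have comparable radii and lie inside each other's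
  balls, so their radii add up to at most `5` and they open at most `5 c` facilities per round in
  expectation (`sum_radius_core_le`).
* Once a facility is open within the radius of a core point, all core points are assigned in that
  round, and the distance of every other point of the cluster to the open facilities is at most
  `10 · δ x` (`dist_le_of_core`). Such a cluster is safe: it stays so forever, and each of its points
  opens with probability at most `10 c · δ x`. By the first item, in a round with core points an
  unsafe cluster becomes safe with probability at least one half. Hence its core points cost `O(1)`
  in total.

The function `potential` collects these costs; it is a supermartingale along the loop
(`expect_loopStep_potential_le`), bounds the number of open facilities and starts at no more than
`20 c` times the cost of `K`.
-/

noncomputable section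

namespace UniFL

/-! ### Expectations -/

/-- The expected value of `g` under `p`, as an extended nonnegative number. -/
def expect {β : Type*} (p : PMF β) (g : β → ℝ≥0∞) : ℝ≥0∞ := ∑' b, p b * g b

section Expect

variable {β γ : Type*}

theorem expect_pure (b : β) (g : β → ℝ≥0∞) : expect (PMF.pure b) g = g b := by
  rw [expect, tsum_eq_single b]
  · simp
  · intro b' hb'
    simp [PMF.pure_apply, hb']

theorem expect_bind (p : PMF β) (q : β → PMF γ) (g : γ → ℝ≥0∞) :
    expect (p.bind q) g = expect p fun a => expect (q a) g := by
  simp only [expect, PMF.bind_apply, ← ENNReal.tsum_mul_right, ← ENNReal.tsum_mul_left]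
  rw [ENNReal.tsum_comm]
  simp only [mul_assoc]

theorem expect_map (p : PMF β) (k : β → γ) (g : γ → ℝ≥0∞) :
    expect (p.map k) g = expect p fun a => g (k a) := by
  rw [← PMF.bind_pure_comp, expect_bind]
  simp only [Function.comp_apply, expect_pure]

theorem expect_mono (p : PMF β) {g h : β → ℝ≥0∞} (H : ∀ b, g b ≤ h b) :
    expect p g ≤ expect p h :=
  ENNReal.tsum_le_tsum fun b => mul_le_mul_right (H b) (p b)

theorem expect_const (p : PMF β) (a : ℝ≥0∞) : expect p (fun _ => a) = a := by
  rw [expect, ENNReal.tsum_mul_right, p.tsum_coe, one_mul]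

theorem expect_add (p : PMF β) (g h : β → ℝ≥0∞) :
    expect p (fun b => g b + h b) = expect p g + expect p h := by
  simp only [expect, mul_add, ENNReal.tsum_add]

theorem expect_const_mul (p : PMF β) (a : ℝ≥0∞) (g : β → ℝ≥0∞) :
    expect p (fun b => a * g b) = a * expect p g := by
  simp only [expect, ← ENNReal.tsum_mul_left, mul_left_comm]

theorem expect_sum (p : PMF β) {ι : Type*} (s : Finset ι) (g : ι → β → ℝ≥0∞) :
    expect p (fun b => ∑ i ∈ s, g i b) = ∑ i ∈ s, expect p (g i) := by
  simp only [expect, Finset.mul_sum]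
  exact Summable.tsum_finsetSum fun _ _ => ENNReal.summable

end Expect

/-! ### Independent random subsets -/

section IndependentSubset

open Classical

variable {β : Type*} (X : Finset β) (p : β → ℝ≥0∞) (hp : ∀ x, p x ≤ 1)

theorem expect_independentSubset (g : Finset β → ℝ≥0∞) :
    expect (independentSubset X p hp) g =
      ∑ S ∈ X.powerset, (∏ x ∈ S, p x) * (∏ x ∈ X \ S, (1 - p x)) * g S := by
  rw [expect, tsum_eq_sum (s := X.powerset)]
  · refine Finset.sum_congr rfl fun S hS => ?_
    rw [independentSubset, PMF.ofFinset_apply, if_pos (Finset.mem_powerset.1 hS)]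
  · intro S hS
    rw [independentSubset, PMF.ofFinset_apply, if_neg fun h => hS (Finset.mem_powerset.2 h),
      zero_mul]

/-- Expectations of products over the points of `X` factor, by independence. -/
theorem expect_independentSubset_prod (g h : β → ℝ≥0∞) :
    expect (independentSubset X p hp) (fun S => (∏ x ∈ S, g x) * ∏ x ∈ X \ S, h x) =
      ∏ x ∈ X, (p x * g x + (1 - p x) * h x) := by
  rw [expect_independentSubset, Finset.prod_add]
  refine Finset.sum_congr rfl fun S _ => ?_
  rw [Finset.prod_mul_distrib, Finset.prod_mul_distrib]
  ring

theorem expect_independentSubset_mem {x : β} (hx : x ∈ X) :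
    expect (independentSubset X p hp) (fun S => if x ∈ S then 1 else 0) = p x := by
  have h1 : expect (independentSubset X p hp) (fun S => if x ∈ S then 1 else 0) =
      expect (independentSubset X p hp)
        (fun S => (∏ y ∈ S, 1) * ∏ y ∈ X \ S, if x = y then 0 else 1) := by
    simp only [expect_independentSubset]
    refine Finset.sum_congr rfl fun S _ => ?_
    rw [Finset.prod_const_one, one_mul, Finset.prod_ite_eq]
    by_cases h : x ∈ S <;> simp [h, hx]
  rw [h1, expect_independentSubset_prod, Finset.prod_eq_single x]
  · simp
  · intro y _ hy
    rw [if_neg hy.symm, mul_one, mul_one, add_tsub_cancel_of_le (hp y)]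
  · exact fun h => absurd hx h

theorem expect_independentSubset_card :
    expect (independentSubset X p hp) (fun S => (S.card : ℝ≥0∞)) = ∑ x ∈ X, p x := by
  have h1 : expect (independentSubset X p hp) (fun S => (S.card : ℝ≥0∞)) =
      expect (independentSubset X p hp) (fun S => ∑ x ∈ X, if x ∈ S then 1 else 0) := by
    simp only [expect_independentSubset]
    refine Finset.sum_congr rfl fun S hS => ?_
    rw [← Finset.sum_filter, Finset.filter_mem_eq_inter,
      Finset.inter_eq_right.2 (Finset.mem_powerset.1 hS)]
    simp
  rw [h1, expect_sum]
  exact Finset.sum_congr rfl fun x hx => expect_independentSubset_mem X p hp hx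

end IndependentSubset

variable {α : Type*} [MetricSpace α]

/-! ### Radii -/

theorem radius_pos {X : Finset α} {x : α} (hx : x ∈ X) : 0 < radius X x :=
  (isRadius_radius hx).1

theorem sum_radius_sub {X : Finset α} {x : α} (hx : x ∈ X) :
    ∑ y ∈ X, max (radius X x - dist y x) 0 = 1 := by
  rw [← sum_ball_eq]
  exact (isRadius_radius hx).2

/-- The radius is a `1`-Lipschitz function of the point. -/
theorem radius_le_add_dist {X : Finset α} {x y : α} (hx : x ∈ X) (hy : y ∈ X) :
    radius X x ≤ radius X y + dist x y := by
  by_contra! h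
  have hlt : ∑ z ∈ X, max (radius X y - dist z y) 0 < ∑ z ∈ X, max (radius X x - dist z x) 0 := by
    refine Finset.sum_lt_sum (fun z _ => max_le_max ?_ le_rfl) ⟨y, hy, ?_⟩
    · linarith [dist_triangle z y x, dist_comm x y]
    · have := radius_pos hy
      rw [dist_self, max_eq_left (by linarith), dist_comm y x, max_eq_left (by linarith)]
      linarith
  rw [sum_radius_sub hx, sum_radius_sub hy] at hlt
  exact lt_irrefl _ hlt

theorem openProb_le_radius {c : ℝ} (hc : 0 ≤ c) (X F : Finset α) (x : α) :
    openProb c X F x ≤ ENNReal.ofReal (c * radius X x) := by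
  rw [ENNReal.ofReal_mul hc]
  exact (min_le_right _ _).trans (min_le_right _ _)

theorem openProb_le_infEDist (c : ℝ) (X F : Finset α) (x : α) :
    openProb c X F x ≤ ENNReal.ofReal c * Metric.infEDist x (F : Set α) :=
  (min_le_right _ _).trans (min_le_left _ _)

open Classical in
/-- After a round, each `x ∈ X` has an open facility at distance at most `r_x` with probability at
least one half. If there is none beforehand, then each `y ∈ X` opens with probability at least
`min {1, c · (r_x - d(x, y))}`, and these weights `r_x - d(x, y)` add up to one over the ball. -/
theorem expect_no_facility_le {c : ℝ} (hc : 1 ≤ c) {X : Finset α} (F : Finset α) {x : α}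
    (hx : x ∈ X) :
    expect (independentSubset X (openProb c X F) (openProb_le_one c X F))
      (fun S => if ∀ f ∈ F ∪ S, radius X x < dist x f then 1 else 0) ≤ 2⁻¹ := by
  by_cases hF : ∃ f ∈ F, dist x f ≤ radius X x
  · obtain ⟨f, hf, hxf⟩ := hF
    refine (expect_mono _ (h := fun _ => 0) fun S => ?_).trans (by rw [expect_const]; exact zero_le)
    rw [if_neg fun h => (h f (Finset.mem_union_left _ hf)).not_ge hxf]
  push Not at hF
  have hc0 : (0 : ℝ) ≤ c := zero_le_one.trans hc
  set w : α → ℝ := fun y => max (radius X x - dist y x) 0 with hw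
  calc _ ≤ expect (independentSubset X (openProb c X F) (openProb_le_one c X F))
        (fun S => (∏ y ∈ S, if dist x y ≤ radius X x then 0 else 1) * ∏ y ∈ X \ S, 1) := by
        refine expect_mono _ fun S => ?_
        split_ifs with h
        · rw [Finset.prod_const_one, mul_one, Finset.prod_eq_one]
          exact fun y hy => if_neg (h y (Finset.mem_union_right _ hy)).not_ge
        · exact zero_le
    _ = ∏ y ∈ X, (openProb c X F y * (if dist x y ≤ radius X x then 0 else 1)
          + (1 - openProb c X F y) * 1) := expect_independentSubset_prod ..
    _ ≤ ∏ y ∈ X, ENNReal.ofReal (Real.exp (-(c * w y))) := by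
        refine Finset.prod_le_prod' fun y hy => ?_
        split_ifs with hxy
        · have hwy : w y = radius X x - dist x y := by
            rw [hw, dist_comm x y] at *
            exact max_eq_left (by linarith)
          have h1 : min 1 (ENNReal.ofReal (c * w y)) ≤ openProb c X F y := by
            refine le_min (min_le_left _ _) ((min_le_right _ _).trans ?_)
            rw [ENNReal.ofReal_mul hc0]
            refine le_min (mul_le_mul_right ?_ _) (mul_le_mul_right ?_ _)
            · rw [Metric.le_infEDist]
              intro f hf
              rw [edist_dist]
              refine ENNReal.ofReal_le_ofReal ?_
              linarith [hF f hf, dist_triangle x y f]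
            · refine ENNReal.ofReal_le_ofReal ?_
              linarith [radius_le_add_dist hx hy]
          rw [mul_zero, zero_add, mul_one]
          calc 1 - openProb c X F y ≤ 1 - min 1 (ENNReal.ofReal (c * w y)) :=
                tsub_le_tsub_left h1 1
            _ ≤ ENNReal.ofReal (1 - c * w y) := by
                rw [tsub_le_iff_right]
                rcases le_total 1 (ENNReal.ofReal (c * w y)) with h | h
                · rw [min_eq_left h]; exact le_add_self
                · rw [min_eq_right h, ← ENNReal.ofReal_one]
                  refine le_trans (ENNReal.ofReal_le_ofReal ?_) ENNReal.ofReal_add_le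
                  linarith
            _ ≤ _ := ENNReal.ofReal_le_ofReal (by linarith [Real.add_one_le_exp (-(c * w y))])
        · have hwy : w y = 0 := by
            rw [dist_comm x y] at hxy
            exact max_eq_right (by linarith)
          rw [hwy, mul_one, mul_one, add_tsub_cancel_of_le (openProb_le_one c X F y)]
          simp
    _ = ENNReal.ofReal (Real.exp (-c)) := by
        rw [← ENNReal.ofReal_prod_of_nonneg fun _ _ => (Real.exp_pos _).le, ← Real.exp_sum,
          Finset.sum_neg_distrib, ← Finset.mul_sum, hw, sum_radius_sub hx, mul_one]
    _ ≤ 2⁻¹ := by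
        have h2 : Real.exp (-c) ≤ 2⁻¹ := by
          rw [Real.exp_neg]
          exact inv_anti₀ two_pos (by linarith [Real.add_one_le_exp c])
        refine (ENNReal.ofReal_le_ofReal h2).trans ?_
        rw [ENNReal.ofReal_inv_of_pos two_pos, ENNReal.ofReal_ofNat]

/-! ### Core points of a cluster -/

section Core

variable {X : Finset α} {f x x₀ : α}

/-- Two points whose radii exceed four times their distance to `f` have comparable radii and lie
well inside each other's balls. -/
theorem radius_le_and_dist_le_of_core (hx : x ∈ X) (hx₀ : x₀ ∈ X) (h : 4 * dist x f < radius X x)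
    (h₀ : 4 * dist x₀ f < radius X x₀) :
    3 * radius X x ≤ 5 * radius X x₀ ∧ 3 * dist x x₀ ≤ 2 * radius X x₀ := by
  have h1 := radius_le_add_dist hx hx₀
  have h2 := dist_triangle_right x x₀ f
  constructor <;> linarith

theorem sum_radius_core_le {T : Finset α} (hT : T ⊆ X) (h : ∀ y ∈ T, 4 * dist y f < radius X y) :
    ∑ y ∈ T, radius X y ≤ 5 := by
  rcases T.eq_empty_or_nonempty with rfl | ⟨x₀, h₀⟩
  · simp
  calc ∑ y ∈ T, radius X y ≤ ∑ y ∈ T, 5 * max (radius X x₀ - dist y x₀) 0 := by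
        refine Finset.sum_le_sum fun y hy => ?_
        have h1 := radius_le_and_dist_le_of_core (hT hy) (hT h₀) (h y hy) (h x₀ h₀)
        linarith [le_max_left (radius X x₀ - dist y x₀) 0]
    _ ≤ ∑ y ∈ X, 5 * max (radius X x₀ - dist y x₀) 0 :=
        Finset.sum_le_sum_of_subset_of_nonneg hT fun _ _ _ => by positivity
    _ = 5 := by rw [← Finset.mul_sum, sum_radius_sub (hT h₀), mul_one]

/-- A facility `g` within the radius of one core point serves all core points, and its distance to
any other point is comparable with the distance of that point to `f`. -/
theorem dist_le_of_core {g : α} (hx : x ∈ X) (hx₀ : x₀ ∈ X) (h₀ : 4 * dist x₀ f < radius X x₀)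
    (hg : dist x₀ g ≤ radius X x₀) : dist x g ≤ 6 * radius X x ∨ dist x g ≤ 10 * dist x f := by
  have h3 := dist_triangle x x₀ g
  by_cases h : 4 * dist x f < radius X x
  · left
    have h1 := radius_le_and_dist_le_of_core hx hx₀ h h₀
    have h2 := radius_le_and_dist_le_of_core hx₀ hx h₀ h
    rw [dist_comm x₀ x] at h2
    linarith [radius_pos hx]
  · right
    push Not at h
    have h1 := radius_le_add_dist hx₀ hx
    have h2 := dist_triangle_right x x₀ f
    rw [dist_comm x₀ x] at h1
    linarith [dist_nonneg (x := x) (y := f)]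

end Core

/-! ### The potential -/

section Potential

open Classical

/-- The points of `X` that stay unassigned when the facilities in `G` are open. -/
def unassigned (X G : Finset α) : Finset α :=
  X.filter fun x => ¬ ∃ f ∈ G, dist x f ≤ 6 * radius X x

/-- In the state `(F, X)`, the cluster of the points that `φ` maps to `f` is unsafe if one of its
points left in `X` is more than ten times as far from `F` as from `f`. -/
def Unsafe (φ : α → α) (f : α) (s : Finset α × Finset α) : Prop :=
  ∃ x ∈ s.2, φ x = f ∧ 10 * edist x f < Metric.infEDist x (s.1 : Set α)

/-- The number of facilities already open, plus a bound for the expected number of facilities yet to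
be opened: `10 c` for each unsafe cluster, and `20 c` times the sum of the distances of the points
left to their centers in the fixed solution `K`, where `φ` maps each point to its center. -/
def potential (c : ℝ) (φ : α → α) (K : Finset α) (s : Finset α × Finset α) : ℝ≥0∞ :=
  s.1.card + ((∑ f ∈ K, ENNReal.ofReal (10 * c) * if Unsafe φ f s then 1 else 0)
    + ∑ x ∈ s.2, ENNReal.ofReal (20 * c) * edist x (φ x))

theorem expect_loopStep {c : ℝ} {F X : Finset α} (hX : X ≠ ∅) (g : Finset α × Finset α → ℝ≥0∞) :
    expect (loopStep c (F, X)) g =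
      expect (independentSubset X (openProb c X F) (openProb_le_one c X F))
        fun S => g (F ∪ S, unassigned X (F ∪ S)) := by
  rw [loopStep, if_neg hX, recursiveUniformFL, expect_map, expect_map]
  simp only [unassigned, ← Finset.union_assoc, Finset.union_idempotent]

theorem expect_sum_unassigned_le {c : ℝ} (hc : 1 ≤ c) (X F : Finset α) (g : α → ℝ≥0∞) :
    expect (independentSubset X (openProb c X F) (openProb_le_one c X F))
      (fun S => ∑ x ∈ unassigned X (F ∪ S), g x) ≤ ∑ x ∈ X, g x * 2⁻¹ := by
  simp only [unassigned, Finset.sum_filter]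
  rw [expect_sum]
  refine Finset.sum_le_sum fun x hx => ?_
  refine le_trans ?_ (mul_le_mul_right (expect_no_facility_le hc F hx) (g x))
  rw [← expect_const_mul]
  refine expect_mono _ fun S => ?_
  by_cases h : ∃ f ∈ F ∪ S, dist x f ≤ 6 * radius X x
  · rw [if_neg (not_not.2 h)]
    exact zero_le
  · rw [if_pos h, if_pos, mul_one]
    intro f hf
    by_contra! hle
    exact h ⟨f, hf, by linarith [radius_pos hx]⟩

theorem Unsafe.of_unassigned {φ : α → α} {f : α} {F S X : Finset α}
    (h : Unsafe φ f (F ∪ S, unassigned X (F ∪ S))) : Unsafe φ f (F, X) := by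
  obtain ⟨x, hx, hxf, hlt⟩ := h
  refine ⟨x, Finset.filter_subset _ _ hx, hxf, hlt.trans_le (Metric.infEDist_anti ?_)⟩
  exact_mod_cast Finset.subset_union_left

/-- A cluster with a core point `x₀` becomes safe unless no facility is open within the radius
of `x₀`. -/
theorem Unsafe.no_facility {φ : α → α} {f x₀ : α} {G X : Finset α} (hx₀ : x₀ ∈ X)
    (h₀ : 4 * dist x₀ f < radius X x₀) (h : Unsafe φ f (G, unassigned X G)) :
    ∀ g ∈ G, radius X x₀ < dist x₀ g := by
  by_contra! hG
  obtain ⟨g, hg, hle⟩ := hG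
  obtain ⟨x, hx, -, hlt⟩ := h
  obtain ⟨hxX, hxG⟩ := Finset.mem_filter.1 hx
  rcases dist_le_of_core hxX hx₀ h₀ hle with h1 | h1
  · exact hxG ⟨g, hg, h1⟩
  · refine hlt.not_ge ((Metric.infEDist_le_edist_of_mem (Finset.mem_coe.2 hg)).trans ?_)
    rw [edist_dist, edist_dist, ← ENNReal.ofReal_ofNat, ← ENNReal.ofReal_mul (by norm_num)]
    exact ENNReal.ofReal_le_ofReal h1

/-- In one round, the expected number of facilities opened in a cluster is paid for by the expected
decrease of the probability of being unsafe, up to the distances of the points to the center. -/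
theorem expect_unsafe_add_sum_openProb_le {c : ℝ} (hc : 1 ≤ c) (φ : α → α) (f : α)
    (X F : Finset α) :
    ENNReal.ofReal (10 * c) * expect (independentSubset X (openProb c X F) (openProb_le_one c X F))
        (fun S => if Unsafe φ f (F ∪ S, unassigned X (F ∪ S)) then 1 else 0)
      + ∑ x ∈ X with φ x = f, openProb c X F x ≤
    ENNReal.ofReal (10 * c) * (if Unsafe φ f (F, X) then 1 else 0)
      + ∑ x ∈ X with φ x = f, ENNReal.ofReal (10 * c) * edist x (φ x) := by
  have hc0 : (0 : ℝ) ≤ c := zero_le_one.trans hc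
  set μ := independentSubset X (openProb c X F) (openProb_le_one c X F)
  by_cases hU : Unsafe φ f (F, X)
  swap
  · have h0 : expect μ (fun S => if Unsafe φ f (F ∪ S, unassigned X (F ∪ S)) then 1 else 0) ≤ 0 := by
      refine (expect_mono _ fun S => ?_).trans_eq (expect_const μ 0)
      exact (if_neg (mt Unsafe.of_unassigned hU)).le
    refine add_le_add (mul_le_mul_right (h0.trans zero_le) _)
      (Finset.sum_le_sum fun x hx => ?_)
    obtain ⟨hxX, hxf⟩ := Finset.mem_filter.1 hx
    have h1 : Metric.infEDist x (F : Set α) ≤ 10 * edist x f := by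
      by_contra! h
      exact hU ⟨x, hxX, hxf, h⟩
    refine (openProb_le_infEDist c X F x).trans ((mul_le_mul_right h1 _).trans_eq ?_)
    rw [hxf, ENNReal.ofReal_mul (by norm_num), ENNReal.ofReal_ofNat]
    ring
  rw [if_pos hU, mul_one]
  have hcheap : ∀ x, ¬ 4 * dist x f < radius X x → φ x = f →
      openProb c X F x ≤ ENNReal.ofReal (10 * c) * edist x (φ x) := by
    intro x hx hxf
    refine (openProb_le_radius hc0 X F x).trans ?_
    rw [hxf, edist_dist, ← ENNReal.ofReal_mul (by positivity)]
    refine ENNReal.ofReal_le_ofReal ?_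
    have hd := dist_nonneg (x := x) (y := f)
    nlinarith [mul_le_mul_of_nonneg_left (not_lt.1 hx) hc0, mul_nonneg hc0 hd]
  by_cases hA : ∃ x₀ ∈ X, 4 * dist x₀ f < radius X x₀
  · obtain ⟨x₀, hx₀, h₀⟩ := hA
    have h1 : expect μ (fun S => if Unsafe φ f (F ∪ S, unassigned X (F ∪ S)) then 1 else 0)
        ≤ 2⁻¹ := by
      refine (expect_mono _ fun S => ?_).trans (expect_no_facility_le hc F hx₀)
      split_ifs with h2 h3 h3
      · exact le_rfl
      · exact absurd (h2.no_facility hx₀ h₀) h3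
      · exact zero_le
      · exact le_rfl
    have h2 : ENNReal.ofReal (10 * c) = ENNReal.ofReal (10 * c) * 2⁻¹ + ENNReal.ofReal (5 * c) := by
      rw [← ENNReal.ofReal_ofNat, ← ENNReal.ofReal_inv_of_pos two_pos,
        ← ENNReal.ofReal_mul (by positivity), ← ENNReal.ofReal_add (by positivity) (by positivity)]
      congr 1
      ring
    nth_rewrite 2 [h2]
    rw [add_assoc]
    refine add_le_add (mul_le_mul_right h1 _) ?_
    rw [← Finset.sum_filter_add_sum_filter_not _ (fun x => 4 * dist x f < radius X x)]
    refine add_le_add ?_ ?_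
    · refine (Finset.sum_le_sum fun x _ => openProb_le_radius hc0 X F x).trans ?_
      rw [← ENNReal.ofReal_sum_of_nonneg, ← Finset.mul_sum]
      · refine ENNReal.ofReal_le_ofReal ?_
        rw [mul_comm]
        refine mul_le_mul_of_nonneg_right (sum_radius_core_le (f := f) (fun x hx => ?_) ?_) hc0
        · exact (Finset.mem_filter.1 (Finset.mem_filter.1 hx).1).1
        · exact fun x hx => (Finset.mem_filter.1 hx).2
      · intro x hx
        exact mul_nonneg hc0 (radius_pos (Finset.mem_filter.1 (Finset.mem_filter.1 hx).1).1).le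
    · refine (Finset.sum_le_sum fun x hx => ?_).trans
        (Finset.sum_le_sum_of_subset (Finset.filter_subset _ _))
      obtain ⟨hx1, hx2⟩ := Finset.mem_filter.1 hx
      exact hcheap x hx2 (Finset.mem_filter.1 hx1).2
  · push Not at hA
    refine add_le_add ?_ (Finset.sum_le_sum fun x hx => ?_)
    · refine mul_le_of_le_one_right' ?_
      refine (expect_mono _ fun S => ?_).trans_eq (expect_const μ 1)
      split_ifs
      exacts [le_rfl, zero_le]
    · obtain ⟨hxX, hxf⟩ := Finset.mem_filter.1 hx
      exact hcheap x (hA x hxX).not_gt hxf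

/-- The potential is a supermartingale. -/
theorem expect_loopStep_potential_le {c : ℝ} (hc : 1 ≤ c) {φ : α → α} {K : Finset α}
    (hφ : ∀ x, φ x ∈ K) (s : Finset α × Finset α) :
    expect (loopStep c s) (potential c φ K) ≤ potential c φ K s := by
  obtain ⟨F, X⟩ := s
  by_cases hX : X = ∅
  · rw [loopStep, if_pos hX, expect_pure]
  rw [expect_loopStep hX]
  set μ := independentSubset X (openProb c X F) (openProb_le_one c X F)
  have hsplit : ∀ g : α → ℝ≥0∞, ∑ x ∈ X, g x = ∑ f ∈ K, ∑ x ∈ X with φ x = f, g x :=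
    fun g => (Finset.sum_fiberwise_of_maps_to (fun x _ => hφ x) g).symm
  have hhalf : ∀ x, ENNReal.ofReal (20 * c) * edist x (φ x) * 2⁻¹
      = ENNReal.ofReal (10 * c) * edist x (φ x) := by
    intro x
    have h20 : ENNReal.ofReal (20 * c) = 2 * ENNReal.ofReal (10 * c) := by
      rw [← ENNReal.ofReal_ofNat 2, ← ENNReal.ofReal_mul (by norm_num)]
      congr 1
      ring
    rw [h20, mul_comm, ← mul_assoc, ← mul_assoc, ENNReal.inv_mul_cancel (by simp) (by simp),
      one_mul]
  have hdouble : ∀ x, ENNReal.ofReal (10 * c) * edist x (φ x) + ENNReal.ofReal (10 * c) *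
      edist x (φ x) = ENNReal.ofReal (20 * c) * edist x (φ x) := by
    intro x
    rw [← hhalf, ← mul_add, ENNReal.inv_two_add_inv_two, mul_one]
  calc _ ≤ expect μ (fun S => ((F.card : ℝ≥0∞) + S.card)
          + ((∑ f ∈ K, ENNReal.ofReal (10 * c) *
              if Unsafe φ f (F ∪ S, unassigned X (F ∪ S)) then 1 else 0)
            + ∑ x ∈ unassigned X (F ∪ S), ENNReal.ofReal (20 * c) * edist x (φ x))) := by
        refine expect_mono _ fun S => add_le_add_left ?_ _
        exact_mod_cast Finset.card_union_le F S
    _ ≤ (F.card + ∑ x ∈ X, openProb c X F x)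
          + ((∑ f ∈ K, ENNReal.ofReal (10 * c) * expect μ
              (fun S => if Unsafe φ f (F ∪ S, unassigned X (F ∪ S)) then 1 else 0))
            + ∑ x ∈ X, ENNReal.ofReal (10 * c) * edist x (φ x)) := by
        rw [expect_add, expect_add, expect_add, expect_const, expect_independentSubset_card,
          expect_sum]
        simp only [expect_const_mul]
        gcongr
        refine (expect_sum_unassigned_le hc X F _).trans_eq ?_
        exact Finset.sum_congr rfl fun x _ => hhalf x
    _ = F.card + ((∑ f ∈ K, (ENNReal.ofReal (10 * c) * expect μ
              (fun S => if Unsafe φ f (F ∪ S, unassigned X (F ∪ S)) then 1 else 0)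
            + ∑ x ∈ X with φ x = f, openProb c X F x))
          + ∑ x ∈ X, ENNReal.ofReal (10 * c) * edist x (φ x)) := by
        rw [Finset.sum_add_distrib, ← hsplit]
        ring
    _ ≤ F.card + ((∑ f ∈ K, (ENNReal.ofReal (10 * c) * (if Unsafe φ f (F, X) then 1 else 0)
            + ∑ x ∈ X with φ x = f, ENNReal.ofReal (10 * c) * edist x (φ x)))
          + ∑ x ∈ X, ENNReal.ofReal (10 * c) * edist x (φ x)) := by
        refine add_le_add_right (add_le_add_left (Finset.sum_le_sum fun f _ => ?_) _) _
        exact expect_unsafe_add_sum_openProb_le hc φ f X F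
    _ = potential c φ K (F, X) := by
        rw [Finset.sum_add_distrib, ← hsplit, add_assoc, ← Finset.sum_add_distrib]
        simp only [hdouble]
        rfl

theorem expect_loopStep_card_le {c : ℝ} (hc : 1 ≤ c) (s : Finset α × Finset α) :
    expect (loopStep c s) (fun t => (t.2.card : ℝ≥0∞)) ≤ 2⁻¹ * s.2.card := by
  obtain ⟨F, X⟩ := s
  by_cases hX : X = ∅
  · rw [loopStep, if_pos hX, expect_pure]
    simp [hX]
  rw [expect_loopStep hX]
  have h := expect_sum_unassigned_le hc X F (fun _ => 1)
  simpa [mul_comm] using h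

end Potential

/-! ### The loop -/

section Loop

variable [Fintype α]

theorem stateLaw_mono (c : ℝ) (F : Finset α) : Monotone fun n => stateLaw c n (F, ∅) := by
  refine monotone_nat_of_le_succ fun n => ?_
  simp only [stateLaw, PMF.bind_apply]
  refine le_trans ?_ (ENNReal.le_tsum (F, ∅))
  simp [loopStep]

theorem expect_stateLaw_potential_le {c : ℝ} (hc : 1 ≤ c) {φ : α → α} {K : Finset α}
    (hφ : ∀ x, φ x ∈ K) (n : ℕ) :
    expect (stateLaw c n) (potential c φ K) ≤ potential c φ K (∅, Finset.univ) := by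
  induction n with
  | zero => rw [stateLaw, expect_pure]
  | succ n ih =>
    rw [stateLaw, expect_bind]
    exact (expect_mono _ fun s => expect_loopStep_potential_le hc hφ s).trans ih

theorem expect_stateLaw_card_le {c : ℝ} (hc : 1 ≤ c) (n : ℕ) :
    expect (stateLaw c n) (fun s : Finset α × Finset α => (s.2.card : ℝ≥0∞))
      ≤ 2⁻¹ ^ n * Fintype.card α := by
  induction n with
  | zero => simp [stateLaw, expect_pure]
  | succ n ih =>
    rw [stateLaw, expect_bind]
    refine (expect_mono _ fun s => expect_loopStep_card_le hc s).trans ?_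
    rw [expect_const_mul, pow_succ', mul_assoc]
    exact mul_le_mul_right ih _

theorem sum_outputProb_mul (c : ℝ) (g : Finset α → ℝ≥0∞) :
    ∑ F : Finset α, outputProb c F * g F = ⨆ n, ∑ F : Finset α, stateLaw c n (F, ∅) * g F := by
  simp only [outputProb, ENNReal.iSup_mul]
  exact ENNReal.finsetSum_iSup_of_monotone fun F _ _ h => mul_le_mul_left (stateLaw_mono c F h) _

theorem sum_stateLaw_le_expect (c : ℝ) (n : ℕ) (g : Finset α × Finset α → ℝ≥0∞) :
    ∑ F : Finset α, stateLaw c n (F, ∅) * g (F, ∅) ≤ expect (stateLaw c n) g := by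
  rw [expect, tsum_fintype, Fintype.sum_prod_type]
  exact Finset.sum_le_sum fun F _ => Finset.single_le_sum
    (f := fun X => stateLaw c n (F, X) * g (F, X)) (fun _ _ => zero_le) (Finset.mem_univ ∅)

theorem sum_outputProb_eq_one {c : ℝ} (hc : 1 ≤ c) :
    ∑ F : Finset α, outputProb c F = 1 := by
  classical
  have h0 := sum_outputProb_mul (α := α) c fun _ => 1
  simp only [mul_one] at h0
  rw [h0]
  refine le_antisymm (iSup_le fun n => ?_) ?_
  · simpa [expect_const] using sum_stateLaw_le_expect (α := α) c n fun _ => 1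
  have hle : ∀ n, 1 ≤ (⨆ n, ∑ F : Finset α, stateLaw c n (F, ∅)) + 2⁻¹ ^ n * Fintype.card α := by
    intro n
    calc (1 : ℝ≥0∞) = expect (stateLaw c n) (fun _ : Finset α × Finset α => 1) :=
          (expect_const _ _).symm
      _ ≤ expect (stateLaw c n) (fun s : Finset α × Finset α =>
            (if s.2 = ∅ then 1 else 0) + (s.2.card : ℝ≥0∞)) := by
          refine expect_mono _ fun s => ?_
          split_ifs with h
          · exact le_self_add
          · rw [zero_add]
            exact_mod_cast Finset.card_pos.2 (Finset.nonempty_iff_ne_empty.2 h)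
      _ ≤ _ := by
          rw [expect_add]
          refine add_le_add (le_trans (le_of_eq ?_) (le_iSup _ n)) (expect_stateLaw_card_le hc n)
          rw [expect, tsum_fintype, Fintype.sum_prod_type]
          simp
  have hlim : Filter.Tendsto (fun n : ℕ => (⨆ n, ∑ F : Finset α, stateLaw c n (F, ∅))
      + (2⁻¹ : ℝ≥0∞) ^ n * Fintype.card α) Filter.atTop
      (nhds ((⨆ n, ∑ F : Finset α, stateLaw c n (F, ∅)) + 0 * Fintype.card α)) := by
    refine tendsto_const_nhds.add (ENNReal.Tendsto.mul_const ?_ (Or.inr (by simp)))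
    exact ENNReal.tendsto_pow_atTop_nhds_zero_of_lt_one (by simp)
  rw [zero_mul, add_zero] at hlim
  exact ge_of_tendsto' hlim hle

theorem potential_init_le {c : ℝ} (hc : 0 ≤ c) {φ : α → α} {K : Finset α}
    (hφ : ∀ x, edist x (φ x) = Metric.infEDist x (K : Set α)) :
    potential c φ K (∅, Finset.univ) ≤ ENNReal.ofReal (20 * c) * cost K := by
  classical
  rw [potential, cost, mul_add, add_comm (ENNReal.ofReal (20 * c) * _), Finset.card_empty,
    Nat.cast_zero, zero_add, Finset.mul_sum]
  simp only [hφ]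
  gcongr
  calc _ ≤ ∑ f ∈ K, ENNReal.ofReal (20 * c) := by
        refine Finset.sum_le_sum fun f _ => ?_
        refine (mul_le_of_le_one_right' ?_).trans (ENNReal.ofReal_le_ofReal (by linarith))
        split_ifs <;> simp
    _ = _ := by rw [Finset.sum_const, nsmul_eq_mul, mul_comm]

theorem expect_card_le_cost {c : ℝ} (hc : 1 ≤ c) (K : Finset α) :
    ∑ F : Finset α, outputProb c F * (F.card : ℝ≥0∞) ≤ ENNReal.ofReal (20 * c) * cost K := by
  have hc0 : 0 < c := zero_lt_one.trans_le hc
  by_cases hK : K.Nonempty ∨ IsEmpty α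
  swap
  · -- On a nonempty space, the empty solution has infinite cost.
    push Not at hK
    obtain ⟨rfl, ⟨x⟩⟩ := hK
    have h1 : cost (∅ : Finset α) = ⊤ := by
      rw [cost, ENNReal.add_eq_top, ENNReal.sum_eq_top]
      exact Or.inl ⟨x, Finset.mem_univ x, by simp⟩
    rw [h1, ENNReal.mul_top (ENNReal.ofReal_pos.2 (by positivity)).ne']
    exact le_top
  have hex : ∀ x : α, ∃ f ∈ K, edist x f = Metric.infEDist x (K : Set α) := by
    intro x
    obtain ⟨f, hf, h⟩ := K.finite_toSet.isCompact.exists_infEDist_eq_edist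
      (Finset.coe_nonempty.2 (hK.resolve_right fun h => h.false x)) x
    exact ⟨f, hf, h.symm⟩
  choose φ hφK hφ using hex
  rw [sum_outputProb_mul]
  refine iSup_le fun n => ?_
  calc _ ≤ expect (stateLaw c n) (fun s : Finset α × Finset α => (s.1.card : ℝ≥0∞)) :=
        sum_stateLaw_le_expect c n fun s => (s.1.card : ℝ≥0∞)
    _ ≤ expect (stateLaw c n) (potential c φ K) := expect_mono _ fun s => le_self_add
    _ ≤ potential c φ K (∅, Finset.univ) := expect_stateLaw_potential_le hc hφK n
    _ ≤ _ := potential_init_le hc0.le hφ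

end Loop

end UniFL

end

/-- For every constant `c ≥ 6` there is a constant `C` such that on every finite metric space
`UniformFLRecursionStart` terminates with probability one, and the set `F` that it returns
satisfies `𝔼 |F| ≤ C · Opt`. -/
theorem proposition4 (c : ℝ) (hc : 6 ≤ c) :
    ∃ C : ℝ≥0, ∀ (α : Type*) [Fintype α] [MetricSpace α],
      (∑ F : Finset α, UniFL.outputProb c F) = 1 ∧
      (∑ F : Finset α, UniFL.outputProb c F * (F.card : ℝ≥0∞)) ≤ C * UniFL.opt α := by
  have hc1 : 1 ≤ c := by linarith
  refine ⟨(20 * c).toNNReal, fun α _ _ => ⟨UniFL.sum_outputProb_eq_one hc1, ?_⟩⟩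
  -- The infimum is attained, because there are finitely many sets `K`.
  obtain ⟨K, hK⟩ := exists_eq_ciInf_of_finite (f := fun K : Finset α => UniFL.cost K)
  rw [UniFL.opt, ← hK]
  exact UniFL.expect_card_le_cost hc1 K
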